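/- Let $G=(V,E)$ be a finite simple graph, let $A\subset V$ and $B = V\setminus A$, and let $|G\rangle=\prod_{\{a,b\}\in E}\mathrm{CZ}_{ab}\,|+\rangle^{\otimes V}$ be the associated graph state, with one qubit for each vertex. Let $G-A$ denote the subgraph of $G$ induced by $B$. For a state $|\psi\rangle$ of $n$ qubits, let $\tau_n(|\psi\rangle)=|\langle\psi|\sigma_y^{\otimes n}|\psi^*\rangle|$, where $|\psi^*\rangle$ is the complex conjugate of $|\psi\rangle$ in the computational basis. Suppose that some vertex in $B$ has no neighbors in $A$ and has even degree in $G-A$. Then every rank-one projective measurement on $A$, local or global, yields only $\tau=0$ states on $B$. That is, for every orthonormal basis $(|\beta_i\rangle)_i$ of the Hilbert space of the qubits in $A$ (an arbitrary basis for a global measurement, a basis of product vectors for a local one), and for every outcome $i$ of positive probability $p_i=\|(\langle\beta_i|_A\otimes I_B)|G\rangle\|^2$, the post-measurement state $|\phi_i\rangle=(\langle\beta_i|_A\otimes I_B)|G\rangle/\sqrt{p_i}$ satisfies $\tau_{|B|}(|\phi_i\rangle)=0$. -/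

import Mathlib

noncomputable section

namespace QState

/-- The Hilbert space of qubits labelled by the finite set `W`. The computational basis vectors
are indexed by the bit assignments `W → Fin 2`. -/
abbrev Qubits (W : Type*) [Fintype W] : Type _ :=
  EuclideanSpace ℂ (W → Fin 2)

/-- The product vector `⨂_w v_w`. -/
def productVector {W : Type*} [Fintype W] (v : W → EuclideanSpace ℂ (Fin 2)) : Qubits W :=
  WithLp.toLp 2 fun x => ∏ w, v w (x w)

/-- The tensor power `M^{⊗ W}` of a single-qubit operator. -/
def tensorPower (W : Type*) [Fintype W] (M : Matrix (Fin 2) (Fin 2) ℂ) :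
    Matrix (W → Fin 2) (W → Fin 2) ℂ :=
  Matrix.of fun x y => ∏ w, M (x w) (y w)

/-! ### The tangle -/

/-- The Pauli matrix `σ_y`. -/
def pauliY : Matrix (Fin 2) (Fin 2) ℂ :=
  !![0, -Complex.I; Complex.I, 0]

/-- Wootters' tilde `σ_y^{⊗ n} |ψ*⟩`, with the complex conjugate taken in the computational
basis. -/
def tilde {W : Type*} [Fintype W] [DecidableEq W] (ψ : Qubits W) : Qubits W :=
  WithLp.toLp 2 (Matrix.mulVec (tensorPower W pauliY) fun x => star (ψ x))

/-- The `n`-tangle `τ_n(ψ) = |⟨ψ|ψ̃⟩|` of a state of the `n` qubits in `W`. -/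
def nTangle {W : Type*} [Fintype W] [DecidableEq W] (ψ : Qubits W) : ℝ :=
  ‖inner ℂ ψ (tilde ψ)‖

/-! ### Graph states -/

/-- The single-qubit state `|+⟩ = (|0⟩ + |1⟩) / √2`. -/
def plus : EuclideanSpace ℂ (Fin 2) :=
  ((Real.sqrt 2)⁻¹ : ℂ) • (EuclideanSpace.single 0 1 + EuclideanSpace.single 1 1)

/-- The controlled-`Z` gate on the qubits `a` and `b`, which multiplies a computational basis
vector by `-1` when both of these qubits are in state `1` and fixes it otherwise. -/
def cz {V : Type*} [Fintype V] (a b : V) : Matrix (V → Fin 2) (V → Fin 2) ℂ :=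
  Matrix.diagonal fun x => if x a = 1 ∧ x b = 1 then -1 else 1

theorem cz_comm {V : Type*} [Fintype V] (a b : V) : cz a b = cz b a := by
  simp only [cz, and_comm]

/-- The controlled-`Z` gate of an unordered pair of qubits. -/
def czEdge {V : Type*} [Fintype V] (e : Sym2 V) : Matrix (V → Fin 2) (V → Fin 2) ℂ :=
  Sym2.lift ⟨cz, cz_comm⟩ e

theorem czEdge_commute {V : Type*} [Fintype V] [DecidableEq V] (e f : Sym2 V) :
    Commute (czEdge e) (czEdge f) := by
  induction e with | _ a b
  induction f with | _ c d
  exact Matrix.commute_diagonal _ _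

theorem czEdge_pairwise_commute {V : Type*} [Fintype V] [DecidableEq V] (s : Set (Sym2 V)) :
    s.Pairwise (Function.onFun Commute czEdge) :=
  fun e _ f _ _ => czEdge_commute e f

/-- The graph state `|G⟩ = ∏_{{a,b} ∈ E} CZ_{ab} |+⟩^{⊗ V}`. -/
def graphState {V : Type*} [Fintype V] [DecidableEq V] (G : SimpleGraph V)
    [DecidableRel G.Adj] : Qubits V :=
  WithLp.toLp 2 (Matrix.mulVec
    (G.edgeFinset.noncommProd czEdge (czEdge_pairwise_commute _))
    (productVector fun _ : V => plus))

/-! ### Rank-one projective measurements of a subset of the qubits -/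

/-- The bit assignment on `V` that restricts to `x` on `A` and to `y` on the complement. -/
def glue {V : Type*} {A : Set V} [DecidablePred (· ∈ A)]
    (x : A → Fin 2) (y : (Aᶜ : Set V) → Fin 2) : V → Fin 2 :=
  fun v => if h : v ∈ A then x ⟨v, h⟩ else y ⟨v, h⟩

/-- The vector `(⟨φ|_A ⊗ I_B) |Ψ⟩`, where `B` is the complement of `A`. -/
def partialInner {V : Type*} [Fintype V] [DecidableEq V] {A : Set V} [DecidablePred (· ∈ A)]
    (φ : Qubits A) (Ψ : Qubits V) : Qubits (Aᶜ : Set V) :=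
  WithLp.toLp 2 fun y => ∑ x : A → Fin 2, star (φ x) * Ψ (glue x y)

/-- The probability `p = ‖(⟨φ|_A ⊗ I_B) |Ψ⟩‖²` of the outcome `|φ⟩⟨φ|` of a measurement of the
qubits in `A`. -/
def outcomeProb {V : Type*} [Fintype V] [DecidableEq V] {A : Set V} [DecidablePred (· ∈ A)]
    (φ : Qubits A) (Ψ : Qubits V) : ℝ :=
  ‖partialInner φ Ψ‖ ^ 2

/-- The state `(⟨φ|_A ⊗ I_B) |Ψ⟩ / √p` of the unmeasured qubits after the outcome `|φ⟩⟨φ|`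
(meaningful when `p > 0`). -/
def postState {V : Type*} [Fintype V] [DecidableEq V] {A : Set V} [DecidablePred (· ∈ A)]
    (φ : Qubits A) (Ψ : Qubits V) : Qubits (Aᶜ : Set V) :=
  ((Real.sqrt (outcomeProb φ Ψ))⁻¹ : ℂ) • partialInner φ Ψ

/-- A rank-one projective measurement, given by an orthonormal basis `β` with measurement operators
`|β_i⟩⟨β_i|`, is local if each of its operators is a tensor product over the individual qubits,
that is, if each `β_i` is a product vector. -/
def IsLocal {W κ : Type*} [Fintype W] [DecidableEq W] [Fintype κ]
    (β : OrthonormalBasis κ ℂ (Qubits W)) : Prop :=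
  ∀ i, ∃ v : W → EuclideanSpace ℂ (Fin 2), β i = productVector v

/-- Every state that the rank-one projective measurement `β` on `A` produces on the remaining
qubits from `Ψ` (with positive probability) is a `τ = 0` state. -/
def YieldsOnlyTauZero {V κ : Type*} [Fintype V] [DecidableEq V] [Fintype κ]
    {A : Set V} [DecidablePred (· ∈ A)]
    (β : OrthonormalBasis κ ℂ (Qubits A)) (Ψ : Qubits V) : Prop :=
  ∀ i, 0 < outcomeProb (β i) Ψ → nTangle (postState (β i) Ψ) = 0

end QState

end

namespace QState

open Finset

/-! The graph state is fixed by `K = X_b ∏_{c ~ b} Z_c`. When `b` has no neighbour in `A`, `K` acts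
on `B` alone, so it commutes with `⟨β_i|_A ⊗ I_B` and fixes every post-measurement state
(`partialInner_graphState_flip`). `X` and `Z` both anticommute with `σ_y`, so conjugating `σ_y^{⊗
B}` by the real operator `K` gives the sign `(-1)^(1 + deg b)`, which is `-1` for even degree. Hence
`⟨ψ|σ_y^{⊗ B}|ψ*⟩` equals its own negative (`nTangle_eq_zero_of_flip`). -/

/-- The sign `(-1)^i` of a bit. -/
def bitSign (i : Fin 2) : ℂ := if i = 1 then -1 else 1

theorem bitSign_mul_of_ne {i j : Fin 2} (h : i ≠ j) : bitSign i * bitSign j = -1 := by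
  fin_cases i <;> fin_cases j <;> simp_all [bitSign]

theorem star_bitSign (i : Fin 2) : star (bitSign i) = bitSign i := by
  fin_cases i <;> simp [bitSign]

theorem pauliY_self (i : Fin 2) : pauliY i i = 0 := by
  fin_cases i <;> simp [pauliY]

/-- Adding `1` to both indices is conjugation by `X`, so this is `X σ_y X = -σ_y`. -/
theorem pauliY_add_one (i j : Fin 2) : pauliY (i + 1) (j + 1) = -pauliY i j := by
  fin_cases i <;> fin_cases j <;> simp [pauliY]

/-- The phase that the controlled-`Z` gate of an edge gives to a computational basis vector. -/
def edgeSign {V : Type*} (x : V → Fin 2) (e : Sym2 V) : ℂ :=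
  Sym2.lift ⟨fun a b => if x a = 1 ∧ x b = 1 then -1 else 1,
    fun a b => by simp only [and_comm]⟩ e

theorem czEdge_eq_diagonal {V : Type*} [Fintype V] (e : Sym2 V) :
    czEdge e = Matrix.diagonal fun x => edgeSign x e := by
  induction e with | _ a b
  rfl

theorem noncommProd_czEdge {V : Type*} [Fintype V] [DecidableEq V] (s : Finset (Sym2 V)) :
    s.noncommProd czEdge (czEdge_pairwise_commute _) =
      Matrix.diagonal fun x => ∏ e ∈ s, edgeSign x e := by
  induction s using Finset.induction_on with
  | empty => simp
  | insert e s he ih =>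
    rw [Finset.noncommProd_insert_of_notMem _ _ _ _ he, ih, czEdge_eq_diagonal,
      Matrix.diagonal_mul_diagonal]
    simp only [Finset.prod_insert he]

theorem plus_apply (i : Fin 2) : plus i = ((Real.sqrt 2)⁻¹ : ℂ) := by
  fin_cases i <;> simp [plus]

theorem graphState_apply {V : Type*} [Fintype V] [DecidableEq V] (G : SimpleGraph V)
    [DecidableRel G.Adj] (x : V → Fin 2) :
    graphState G x =
      (∏ e ∈ G.edgeFinset, edgeSign x e) * ((Real.sqrt 2)⁻¹ : ℂ) ^ Fintype.card V := by
  simp [graphState, noncommProd_czEdge, Matrix.mulVec_diagonal, productVector, plus_apply]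

section Flip

variable {V : Type*} [DecidableEq V]

theorem edgeSign_flip_of_notMem {x : V → Fin 2} {b : V} {e : Sym2 V} (h : b ∉ e) :
    edgeSign (x + Pi.single b 1) e = edgeSign x e := by
  induction e with | _ c d
  simp only [Sym2.mem_iff, not_or] at h
  simp [edgeSign, Pi.single_eq_of_ne' h.1, Pi.single_eq_of_ne' h.2]

theorem edgeSign_flip {x : V → Fin 2} {b c : V} (h : c ≠ b) :
    edgeSign (x + Pi.single b 1) s(b, c) = bitSign (x c) * edgeSign x s(b, c) := by
  simp only [edgeSign, Sym2.lift_mk, Pi.add_apply, Pi.single_eq_same, Pi.single_eq_of_ne h,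
    add_zero, bitSign]
  generalize x b = i
  generalize x c = j
  fin_cases i <;> fin_cases j <;> simp

/-- Only edges `{b, c}` at `b` notice the flip, and such an edge changes sign exactly when `x c =
1`. -/
theorem prod_edgeSign_flip [Fintype V] (G : SimpleGraph V) [DecidableRel G.Adj]
    (x : V → Fin 2) (b : V) :
    ∏ e ∈ G.edgeFinset, edgeSign (x + Pi.single b 1) e =
      (∏ c ∈ G.neighborFinset b, bitSign (x c)) * ∏ e ∈ G.edgeFinset, edgeSign x e := by
  have himg : G.edgeFinset.filter (b ∈ ·) = (G.neighborFinset b).image (s(b, ·)) := by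
    ext e
    induction e with | _ c d
    simp only [mem_filter, SimpleGraph.mem_edgeFinset, SimpleGraph.mem_edgeSet, Sym2.mem_iff,
      mem_image, SimpleGraph.mem_neighborFinset]
    constructor
    · rintro ⟨h, rfl | rfl⟩
      · exact ⟨d, h, rfl⟩
      · exact ⟨c, h.symm, Sym2.eq_swap⟩
    · rintro ⟨a, h, he⟩
      rcases Sym2.eq_iff.1 he with ⟨rfl, rfl⟩ | ⟨rfl, rfl⟩
      · exact ⟨h, Or.inl rfl⟩
      · exact ⟨h.symm, Or.inr rfl⟩
  have hinj : Set.InjOn (fun c => s(b, c)) (G.neighborFinset b) :=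
    fun c _ d _ h => Sym2.congr_right.1 h
  rw [← prod_filter_mul_prod_filter_not G.edgeFinset (b ∈ ·),
    ← prod_filter_mul_prod_filter_not G.edgeFinset (b ∈ ·) (edgeSign x), himg,
    prod_image hinj, prod_image hinj, ← mul_assoc, ← prod_mul_distrib]
  congr 1
  · refine prod_congr rfl fun c hc => edgeSign_flip ?_
    exact ((G.mem_neighborFinset b c).1 hc).ne'
  · exact prod_congr rfl fun e he => edgeSign_flip_of_notMem (mem_filter.1 he).2

/-- The graph state is stabilized by `X_b ∏_{c ~ b} Z_c`. -/
theorem graphState_flip [Fintype V] (G : SimpleGraph V) [DecidableRel G.Adj]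
    (x : V → Fin 2) (b : V) :
    graphState G (x + Pi.single b 1) =
      (∏ c ∈ G.neighborFinset b, bitSign (x c)) * graphState G x := by
  rw [graphState_apply, graphState_apply, prod_edgeSign_flip, mul_assoc]

variable {A : Set V} [DecidablePred (· ∈ A)]

theorem glue_coe {V : Type*} {A : Set V} [DecidablePred (· ∈ A)] (x : A → Fin 2)
    (y : (Aᶜ : Set V) → Fin 2) (c : (Aᶜ : Set V)) :
    glue x y c = y c :=
  dif_neg c.2

theorem glue_flip (x : A → Fin 2) (y : (Aᶜ : Set V) → Fin 2) (b : (Aᶜ : Set V)) :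
    glue x (y + Pi.single b 1) = glue x y + Pi.single (b : V) 1 := by
  funext v
  by_cases hv : v ∈ A
  · have hne : v ≠ b := fun h => b.2 (h ▸ hv)
    simp [glue, hv, Pi.single_eq_of_ne hne]
  · simp [glue, hv, Pi.single_apply, Subtype.ext_iff]

/-- If `b` has no neighbour in `A`, then the stabilizer `X_b ∏_{c ~ b} Z_c` of the graph state acts
on the unmeasured qubits only, and therefore stabilizes each unnormalized post-measurement
state. -/
theorem partialInner_graphState_flip [Fintype V] (G : SimpleGraph V) [DecidableRel G.Adj]
    (φ : Qubits A) {b : (Aᶜ : Set V)} (hb : ∀ a ∈ A, ¬ G.Adj b a)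
    (y : (Aᶜ : Set V) → Fin 2) :
    partialInner φ (graphState G) (y + Pi.single b 1) =
      (∏ c ∈ (G.induce Aᶜ).neighborFinset b, bitSign (y c)) *
        partialInner φ (graphState G) y := by
  -- This is where `hb` enters: the sign from the flip involves only bits of `y`, so it factors out
  -- of the sum over `x`.
  have hN : G.neighborFinset b =
      ((G.induce Aᶜ).neighborFinset b).map (Function.Embedding.subtype _) := by
    ext c
    simp only [SimpleGraph.mem_neighborFinset, mem_map, SimpleGraph.comap_adj]
    constructor
    · exact fun h => ⟨⟨c, fun hc => hb c hc h⟩, h, rfl⟩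
    · rintro ⟨c, h, rfl⟩
      exact h
  simp only [partialInner, mul_sum]
  refine sum_congr rfl fun x _ => ?_
  rw [glue_flip, graphState_flip, hN, prod_map]
  simp only [Function.Embedding.subtype_apply, glue_coe]
  ring

end Flip

section Tangle

variable {W : Type*} [Fintype W] [DecidableEq W]

theorem tensorPower_pauliY_eq_zero {W : Type*} [Fintype W] {x y : W → Fin 2} {w : W}
    (h : x w = y w) :
    tensorPower W pauliY x y = 0 :=
  prod_eq_zero (mem_univ w) (by rw [h, pauliY_self])

theorem tensorPower_pauliY_flip (x y : W → Fin 2) (b : W) :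
    tensorPower W pauliY (x + Pi.single b 1) (y + Pi.single b 1) =
      -tensorPower W pauliY x y := by
  simp only [tensorPower, Matrix.of_apply]
  rw [← mul_prod_erase univ _ (mem_univ b),
    ← mul_prod_erase univ (fun w => pauliY (x w) (y w)) (mem_univ b), ← neg_mul]
  congr 1
  · simp [pauliY_add_one]
  · refine prod_congr rfl fun w hw => ?_
    simp [Pi.single_eq_of_ne (ne_of_mem_erase hw)]

/-- Both amplitudes occur conjugated, so a sign rule for `ψ` contributes the product of its signs at
`x` and `y`. -/
theorem inner_tilde (ψ : Qubits W) :
    inner ℂ ψ (tilde ψ) =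
      ∑ x, ∑ y, star (ψ x) * (tensorPower W pauliY x y * star (ψ y)) := by
  simp [PiLp.inner_apply, tilde, Matrix.mulVec, dotProduct, mul_sum, mul_comm, mul_left_comm]

/-- A vector stabilized by `X_b ∏_{c ∈ s} Z_c` with `|s|` even has vanishing `n`-tangle. -/
theorem nTangle_eq_zero_of_flip {ψ : Qubits W} (b : W) {s : Finset W} (hs : Even #s)
    (hψ : ∀ x, ψ (x + Pi.single b 1) = (∏ c ∈ s, bitSign (x c)) * ψ x) :
    nTangle ψ = 0 := by
  have hterm (x y : W → Fin 2) :
      star (ψ (x + Pi.single b 1)) * (tensorPower W pauliY (x + Pi.single b 1)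
          (y + Pi.single b 1) * star (ψ (y + Pi.single b 1))) =
        -(star (ψ x) * (tensorPower W pauliY x y * star (ψ y))) := by
    rw [tensorPower_pauliY_flip]
    -- `σ_y` has zero diagonal, so only complementary `x` and `y` contribute; for these each `c ∈ s`
    -- gives a factor `-1`, and `#s` is even.
    by_cases hxy : ∃ w, x w = y w
    · obtain ⟨w, hw⟩ := hxy
      simp [tensorPower_pauliY_eq_zero hw]
    · push Not at hxy
      have hsign : (∏ c ∈ s, bitSign (x c)) * ∏ c ∈ s, bitSign (y c) = 1 := by
        rw [← prod_mul_distrib, prod_congr rfl fun c _ => bitSign_mul_of_ne (hxy c), prod_const,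
          hs.neg_one_pow]
      simp only [hψ, star_mul', star_prod, star_bitSign]
      linear_combination
        (-(star (ψ x) * (tensorPower W pauliY x y * star (ψ y)))) * hsign
  have hneg : inner ℂ ψ (tilde ψ) = -inner ℂ ψ (tilde ψ) := by
    rw [inner_tilde, ← sum_neg_distrib]
    -- Flipping bit `b` is a bijection of assignments; it is applied to `x` here and to `y` below.
    conv_lhs => rw [← Equiv.sum_comp (Equiv.addRight (Pi.single b 1))]
    refine sum_congr rfl fun x _ => ?_
    rw [← sum_neg_distrib]
    conv_lhs => rw [← Equiv.sum_comp (Equiv.addRight (Pi.single b 1))]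
    exact sum_congr rfl fun y _ => hterm x y
  rw [nTangle, self_eq_neg.1 hneg, norm_zero]

end Tangle

theorem yieldsOnlyTauZero_graphState {V κ : Type*} [Fintype V] [DecidableEq V] [Fintype κ]
    (G : SimpleGraph V) [DecidableRel G.Adj] {A : Set V} [DecidablePred (· ∈ A)]
    {b : (Aᶜ : Set V)} (hb : ∀ a ∈ A, ¬ G.Adj b a) (hdeg : Even ((G.induce Aᶜ).degree b))
    (β : OrthonormalBasis κ ℂ (Qubits A)) : YieldsOnlyTauZero β (graphState G) := by
  intro i _
  refine nTangle_eq_zero_of_flip b hdeg fun y => ?_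
  -- The flip relation is linear, so it survives normalization.
  simp only [postState, PiLp.smul_apply, smul_eq_mul, partialInner_graphState_flip G (β i) hb y]
  ring

end QState

theorem mainTheorem10 {V κ : Type*} [Fintype V] [DecidableEq V] [Fintype κ]
    (G : SimpleGraph V) [DecidableRel G.Adj] (A : Set V) [DecidablePred (· ∈ A)]
    (h : ∃ b : (Aᶜ : Set V), (∀ a ∈ A, ¬ G.Adj b a) ∧ Even ((G.induce Aᶜ).degree b)) :
    (∀ β : OrthonormalBasis κ ℂ (QState.Qubits A),
      QState.YieldsOnlyTauZero β (QState.graphState G)) ∧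
    (∀ β : OrthonormalBasis κ ℂ (QState.Qubits A), QState.IsLocal β →
      QState.YieldsOnlyTauZero β (QState.graphState G)) := by
  obtain ⟨b, hb, hdeg⟩ := h
  exact ⟨fun β => QState.yieldsOnlyTauZero_graphState G hb hdeg β,
    fun β _ => QState.yieldsOnlyTauZero_graphState G hb hdeg β⟩
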